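/- All graphs are finite and simple. For a graph $G$ on $n$ vertices let $L(G)$ be its Laplacian matrix. Its Smith normal form is the unique diagonal matrix $\operatorname{diag}(d_1,\dots,d_n)=P\,L(G)\,Q$ with $P,Q\in GL_n(\mathbb Z)$, $d_i\ge 0$ and $d_1\mid d_2\mid\cdots\mid d_n$. The nonzero $d_i$ are the invariant factors of $L(G)$; they are also called the invariant factors of the critical group of $G$, which is the torsion part of $\mathbb Z^n/\operatorname{Im}L(G)$. Let $\mathcal K_{\le 3}$ be the family of connected simple graphs whose critical group has at most $3$ invariant factors equal to $1$. For a graph $H$ with vertex set $U$ and $\mathbf d\in\mathbb Z^{U}$, let $H^{\mathbf d}$ be the graph obtained by replacing each vertex $u$ of $H$ by a set $V_u$ of $|\mathbf d_u|$ vertices, which is a clique if $\mathbf d_u<0$ and a stable set if $\mathbf d_u>0$, where for $u\neq v$ each vertex of $V_u$ is adjacent to each vertex of $V_v$ if and only if $u$ and $v$ are adjacent in $H$. **Theorem.** Let $G$ be a connected simple regular graph. Then $G\in\mathcal K_{\le 3}$ if and only if $G$ is isomorphic to one of the following graphs: (a) the cycle $C_5$; (b) the triangular prism $K_3\,\Box\,K_2$;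 (c) a complete graph $K_r$, $r\ge 1$; (d) a regular complete bipartite graph $K_{r,r}$, $r\ge 1$; (e) a regular complete tripartite graph $K_{r,r,r}$, $r\ge 1$; (f) a regular complete $4$-partite graph $K_{r,r,r,r}$, $r\ge 1$; (g) $C_4^{(-r,-r,-r,-r)}$, $r\ge 1$, where $C_4$ is the cycle on $4$ vertices. -/

import Mathlib

/-- `IsSmithNormalForm M d` says that the integer square matrix `M` has Smith normal form
`diag(d 0, d 1, …, d (n-1))`: each `d i` is a nonnegative integer that divides all later ones
(so the zeros, if any, come last), and, after numbering the index set of `M` by `Fin n`, the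
diagonal matrix is `P * M * Q` for some `P, Q` invertible over `ℤ`.
The invariant factors of `M` are the nonzero `d i`. -/
def IsSmithNormalForm {V : Type*} [Fintype V] [DecidableEq V]
    (M : Matrix V V ℤ) (d : Fin (Fintype.card V) → ℕ) : Prop :=
  (∀ i j, i ≤ j → d i ∣ d j) ∧
    ∃ (e : Fin (Fintype.card V) ≃ V) (P Q : Matrix V V ℤ), IsUnit P ∧ IsUnit Q ∧
      (P * M * Q).submatrix e e = Matrix.diagonal (fun i => (d i : ℤ))

/-- The matrix `M` has at most `k` invariant factors equal to `1`. Every integer matrix has exactly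
one Smith normal form, so "some Smith normal form of `M`" means "the Smith normal form of `M`". -/
def AtMostInvariantFactorsOne {V : Type*} [Fintype V] [DecidableEq V]
    (M : Matrix V V ℤ) (k : ℕ) : Prop :=
  ∃ d : Fin (Fintype.card V) → ℕ, IsSmithNormalForm M d ∧
    (Finset.univ.filter (fun i => d i = 1)).card ≤ k

/-- The family `𝒦_{≤ k}`: connected simple graphs whose critical group has at most `k` invariant
factors equal to `1`. The critical group is the torsion part of the cokernel of the Laplacian
matrix, and its invariant factors are those of the Laplacian matrix. -/
def InCriticalFamilyLE {V : Type*} [Fintype V] [DecidableEq V]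
    (G : SimpleGraph V) [DecidableRel G.Adj] (k : ℕ) : Prop :=
  G.Connected ∧ AtMostInvariantFactorsOne (G.lapMatrix ℤ) k

/-- The graph `G^d` for `d : V → ℤ`: each vertex `u` of `G` is replaced by a set `V_u` of
`|d u|` vertices, which is a clique if `d u < 0` and a stable set if `d u > 0`; for `u ≠ v`, every
vertex of `V_u` is adjacent to every vertex of `V_v` if and only if `u` and `v` are adjacent. -/
def thickGraph {V : Type*} (G : SimpleGraph V) (d : V → ℤ) :
    SimpleGraph (Σ u : V, Fin (d u).natAbs) where
  Adj x y := G.Adj x.1 y.1 ∨ (x ≠ y ∧ x.1 = y.1 ∧ d x.1 < 0)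
  symm.symm x y h := by
    rcases h with h | ⟨h1, h2, h3⟩
    · exact Or.inl h.symm
    · exact Or.inr ⟨h1.symm, h2.symm, h2 ▸ h3⟩
  loopless.irrefl x h := by
    rcases h with h | ⟨h1, _⟩
    · exact G.loopless.irrefl _ h
    · exact h1 rfl

/-! In a divisibility chain at most `k` entries equal 1 exactly when some prime divides every entry
after the `k`-th. So membership means that the Laplacian has rank at most 3 modulo some prime p
(`atMostInvariantFactorsOne_iff`). If G is k-regular, the Laplacian mod p is -(A + tI) with t = -k,
and the question is which connected regular graphs make all 4×4 minors of A + tI vanish over F_p.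

Let t = 1 and G be not complete. An induced path a, b, c gives an invertible 3×3 block, so the
matrix is determined by the adjacencies to a, b, c. The diagonal entries and regularity force p = 3
and leave four adjacency patterns, the cliques of a blown-up C_4 (`shift_one_classification`).

Let t ≠ 1. There is no K_5, so if nonadjacency is transitive, as it is when t = 0, G is complete
multipartite with at most four parts, of equal size by regularity. Otherwise t ≠ 0 and p ≠ 2. Two
nonadjacent vertices with different neighbourhoods then have a Schur complement of rank at most one,
and there are no independent triples. This leaves C_5 with t² = t + 1, or the prism with p = 5 and t
= 2 (`shift_generic_classification`).

Conversely, each graph on more than three vertices has a prime with an explicit factorization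
through dimension 3: 5 for C_5 and the prism, 3 for four parts and for the blown-up C_4, a divisor
of n for K_n, a divisor of r for two or three parts. -/

/-! ### Existence of the Smith normal form over ℤ. -/

/-- Two integer square matrices are unimodularly equivalent if one is obtained from the other by
multiplication on both sides with matrices invertible over `ℤ`. -/
def UnimodularEquivalent {ι : Type*} [Fintype ι] [DecidableEq ι] (M N : Matrix ι ι ℤ) : Prop :=
  ∃ P Q : Matrix ι ι ℤ, IsUnit P ∧ IsUnit Q ∧ P * M * Q = N

namespace UnimodularEquivalent

variable {ι κ : Type*} [Fintype ι] [DecidableEq ι] [Fintype κ] [DecidableEq κ]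

theorem refl (M : Matrix ι ι ℤ) : UnimodularEquivalent M M :=
  ⟨1, 1, isUnit_one, isUnit_one, by simp⟩

theorem trans {M N K : Matrix ι ι ℤ} (h₁ : UnimodularEquivalent M N)
    (h₂ : UnimodularEquivalent N K) : UnimodularEquivalent M K := by
  obtain ⟨P, Q, hP, hQ, rfl⟩ := h₁
  obtain ⟨P', Q', hP', hQ', rfl⟩ := h₂
  exact ⟨P' * P, Q * Q', hP'.mul hP, hQ.mul hQ', by simp only [Matrix.mul_assoc]⟩

theorem mul_left {M N P : Matrix ι ι ℤ} (h : UnimodularEquivalent M N) (hP : IsUnit P) :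
    UnimodularEquivalent M (P * N) :=
  h.trans ⟨P, 1, hP, isUnit_one, by simp⟩

theorem mul_right {M N Q : Matrix ι ι ℤ} (h : UnimodularEquivalent M N) (hQ : IsUnit Q) :
    UnimodularEquivalent M (N * Q) :=
  h.trans ⟨1, Q, isUnit_one, hQ, by simp⟩

theorem isUnit_submatrix {P : Matrix ι ι ℤ} (hP : IsUnit P) (e : κ ≃ ι) :
    IsUnit (P.submatrix e e) := by
  rw [Matrix.isUnit_iff_isUnit_det] at hP ⊢
  rwa [Matrix.det_submatrix_equiv_self]

theorem submatrix {M N : Matrix ι ι ℤ} (h : UnimodularEquivalent M N) (e : κ ≃ ι) :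
    UnimodularEquivalent (M.submatrix e e) (N.submatrix e e) := by
  obtain ⟨P, Q, hP, hQ, rfl⟩ := h
  exact ⟨P.submatrix e e, Q.submatrix e e, isUnit_submatrix hP e, isUnit_submatrix hQ e, by
    simp only [Matrix.submatrix_mul_equiv]⟩

theorem permute {M N : Matrix ι ι ℤ} (h : UnimodularEquivalent M N) (σ τ : Equiv.Perm ι) :
    UnimodularEquivalent M (N.submatrix σ τ) := by
  refine h.trans ⟨(1 : Matrix ι ι ℤ).submatrix σ id, (1 : Matrix ι ι ℤ).submatrix id τ, ?_, ?_, ?_⟩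
  · rw [Matrix.isUnit_iff_isUnit_det, Matrix.det_permute]
    simp
  · rw [Matrix.isUnit_iff_isUnit_det, Matrix.det_permute']
    simp
  · ext i j
    simp [Matrix.mul_apply, Matrix.submatrix_apply, Matrix.one_apply]

theorem isUnit_transvection {i j : ι} (hij : i ≠ j) (c : ℤ) : IsUnit (Matrix.transvection i j c) := by
  rw [Matrix.isUnit_iff_isUnit_det, Matrix.det_transvection_of_ne _ _ hij]
  exact isUnit_one

/-- An entry of least nonzero absolute value among all equivalent matrices divides its column. -/
theorem dvd_of_minimal_col {M N : Matrix ι ι ℤ} (h : UnimodularEquivalent M N) {a : ι} {b : ι}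
    (h0 : N a b ≠ 0) (hmin : ∀ K, UnimodularEquivalent M K → ∀ i j, K i j ≠ 0 →
      (N a b).natAbs ≤ (K i j).natAbs) (i : ι) : N a b ∣ N i b := by
  by_cases hi : i = a
  · rw [hi]
  have h1 := hmin _ (h.mul_left (isUnit_transvection hi (-(N i b / N a b)))) i b
  rw [Matrix.transvection_mul_apply_same] at h1
  have h2 : N i b + -(N i b / N a b) * N a b = N i b % N a b := by
    rw [Int.emod_def]; ring
  rw [h2] at h1
  by_contra hd
  have h3 := h1 fun h => hd (Int.dvd_of_emod_eq_zero h)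
  have h4 := Int.emod_nonneg (N i b) h0
  have h5 := Int.emod_lt (N i b) h0
  omega

/-- An entry of least nonzero absolute value among all equivalent matrices divides its row. -/
theorem dvd_of_minimal_row {M N : Matrix ι ι ℤ} (h : UnimodularEquivalent M N) {a : ι} {b : ι}
    (h0 : N a b ≠ 0) (hmin : ∀ K, UnimodularEquivalent M K → ∀ i j, K i j ≠ 0 →
      (N a b).natAbs ≤ (K i j).natAbs) (j : ι) : N a b ∣ N a j := by
  by_cases hj : j = b
  · rw [hj]
  have h1 := hmin _ (h.mul_right (isUnit_transvection (Ne.symm hj) (-(N a j / N a b)))) a j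
  rw [Matrix.mul_transvection_apply_same] at h1
  have h2 : N a j + -(N a j / N a b) * N a b = N a j % N a b := by
    rw [Int.emod_def]; ring
  rw [h2] at h1
  by_contra hd
  have h3 := h1 fun h => hd (Int.dvd_of_emod_eq_zero h)
  have h4 := Int.emod_nonneg (N a j) h0
  have h5 := Int.emod_lt (N a j) h0
  omega

open Matrix in
/-- A nonzero matrix is equivalent to a block matrix with a `1 × 1` block dividing the rest. -/
theorem exists_fromBlocks {n : ℕ} (M : Matrix (Unit ⊕ Fin n) (Unit ⊕ Fin n) ℤ) (hM : M ≠ 0) :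
    ∃ (a : ℕ) (D : Matrix (Fin n) (Fin n) ℤ), (∀ i j, (a : ℤ) ∣ D i j) ∧
      UnimodularEquivalent M (fromBlocks (of fun _ _ => (a : ℤ)) 0 0 D) := by
  classical
  -- Minimality is taken over the whole equivalence class, so any nonzero division remainder
  -- contradicts it.
  have hex : ∃ k : ℕ, k ≠ 0 ∧ ∃ N, UnimodularEquivalent M N ∧ ∃ i j, (N i j).natAbs = k := by
    by_contra! hcon
    refine hM (Matrix.ext fun i j => ?_)
    by_contra h
    exact hcon _ (Int.natAbs_ne_zero.2 h) M (refl M) i j rfl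
  obtain ⟨a, h0, N₀, hN₀, i₀, j₀, hij₀, hmin⟩ : ∃ a : ℕ, a ≠ 0 ∧ ∃ N, UnimodularEquivalent M N ∧
      ∃ i j, (N i j).natAbs = a ∧
        ∀ K, UnimodularEquivalent M K → ∀ i j, K i j ≠ 0 → a ≤ (K i j).natAbs := by
    obtain ⟨h0, N, hN, i, j, hij⟩ := Nat.find_spec hex
    exact ⟨_, h0, N, hN, i, j, hij, fun K hK i j h =>
      Nat.find_min' hex ⟨Int.natAbs_ne_zero.2 h, K, hK, i, j, rfl⟩⟩
  obtain ⟨N, hN, hNa⟩ : ∃ N, UnimodularEquivalent M N ∧ N (.inl ()) (.inl ()) = (a : ℤ) := by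
    have h1 := hN₀.permute (Equiv.swap (.inl ()) i₀) (Equiv.swap (.inl ()) j₀)
    rcases Int.natAbs_eq (N₀ i₀ j₀) with h | h <;> rw [hij₀] at h
    · exact ⟨_, h1, by simp [h]⟩
    · refine ⟨_, h1.mul_left (P := -1) isUnit_one.neg, ?_⟩
      rw [Matrix.neg_mul, Matrix.one_mul]
      simp [h]
  have ha0 : (a : ℤ) ≠ 0 := by exact_mod_cast h0
  have hcol : ∀ K, UnimodularEquivalent M K → K (.inl ()) (.inl ()) = (a : ℤ) →
      ∀ i, (a : ℤ) ∣ K i (.inl ()) := fun K hK hKa i => by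
    rw [← hKa]
    exact dvd_of_minimal_col hK (by rwa [hKa]) (by simpa [hKa] using hmin) i
  have hrow : ∀ K, UnimodularEquivalent M K → K (.inl ()) (.inl ()) = (a : ℤ) →
      ∀ i, (a : ℤ) ∣ K (.inl ()) i := fun K hK hKa i => by
    rw [← hKa]
    exact dvd_of_minimal_row hK (by rwa [hKa]) (by simpa [hKa] using hmin) i
  choose c hc using fun i : Fin n => hcol N hN hNa (.inr i)
  choose r hr using fun i : Fin n => hrow N hN hNa (.inr i)
  let A : Matrix Unit Unit ℤ := of fun _ _ => (a : ℤ)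
  let C : Matrix (Fin n) Unit ℤ := of fun i _ => c i
  let R : Matrix Unit (Fin n) ℤ := of fun _ i => r i
  let D := N.toBlocks₂₂
  have hNb : N = fromBlocks A (A * R) (C * A) D := by
    ext i j
    rcases i with i | i <;> rcases j with j | j
    · simpa [A] using hNa
    · simpa [A, R, Matrix.mul_apply] using hr j
    · simpa [A, C, Matrix.mul_apply, mul_comm] using hc i
    · simp [D, toBlocks₂₂]
  have hK : UnimodularEquivalent M (fromBlocks A 0 0 (D - C * A * R)) := by
    refine hN.trans ⟨fromBlocks 1 0 (-C) 1, fromBlocks 1 (-R) 0 1,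
      isUnit_fromBlocks_zero₁₂.2 ⟨isUnit_one, isUnit_one⟩,
      isUnit_fromBlocks_zero₂₁.2 ⟨isUnit_one, isUnit_one⟩, ?_⟩
    rw [hNb, fromBlocks_multiply, fromBlocks_multiply]
    congr 1 <;> simp [Matrix.mul_assoc]
    abel
  refine ⟨a, D - C * A * R, fun i j => ?_, hK⟩
  -- Adding row i of the lower block to the pivot row keeps the pivot `a`, so `a` divides the new
  -- pivot row, which contains `D i j`.
  have h2 := hK.mul_left (P := fromBlocks 1 (of fun _ k => if k = i then 1 else 0) 0 1)
    (isUnit_fromBlocks_zero₂₁.2 ⟨isUnit_one, isUnit_one⟩)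
  rw [fromBlocks_multiply] at h2
  have h3 := hrow _ h2 (by simp [A]) (.inr j)
  simpa [Matrix.mul_apply] using h3

theorem exists_diagonal (n : ℕ) (M : Matrix (Fin n) (Fin n) ℤ) :
    ∃ d : Fin n → ℕ, (∀ i j, i ≤ j → d i ∣ d j) ∧
      UnimodularEquivalent M (Matrix.diagonal fun i => (d i : ℤ)) := by
  induction n with
  | zero => exact ⟨fun _ => 0, fun i => i.elim0, 1, 1, isUnit_one, isUnit_one,
      Matrix.ext fun i => i.elim0⟩
  | succ n ih =>
    by_cases hM : M = 0
    · exact ⟨fun _ => 0, fun _ _ _ => dvd_rfl, by simpa [hM] using refl (0 : Matrix _ _ ℤ)⟩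
    let e : Unit ⊕ Fin n ≃ Fin (n + 1) :=
      (Equiv.sumComm _ _).trans ((Equiv.optionEquivSumPUnit _).symm.trans (finSuccEquiv n).symm)
    have he : ∀ x, e x = Sum.elim (fun _ => 0) Fin.succ x := by
      rintro (x | x) <;> simp [e]
    have hes : ∀ x : Fin n, e.symm x.succ = .inr x := fun x => by
      rw [Equiv.symm_apply_eq, he]; rfl
    have he0 : e.symm 0 = .inl () := by
      rw [Equiv.symm_apply_eq, he]; rfl
    have hM' : M.submatrix e e ≠ 0 := fun h => hM <| by
      ext i j
      simpa using congrFun (congrFun h (e.symm i)) (e.symm j)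
    obtain ⟨a, D, hD, hE⟩ := exists_fromBlocks _ hM'
    obtain ⟨d, hd, P, Q, hP, hQ, hPQ⟩ := ih D
    have had : ∀ i, a ∣ d i := fun i => by
      have h1 : (P * D * Q) i i = d i := by rw [hPQ]; simp
      have h2 : (a : ℤ) ∣ (P * D * Q) i i := by
        rw [Matrix.mul_apply]
        refine Finset.dvd_sum fun k _ => Dvd.dvd.mul_right ?_ _
        rw [Matrix.mul_apply]
        exact Finset.dvd_sum fun l _ => Dvd.dvd.mul_left (hD _ _) _
      rw [h1] at h2
      exact_mod_cast h2
    refine ⟨Fin.cons a d, fun i j => ?_, ?_⟩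
    · refine Fin.cases ?_ (fun i => ?_) i
      · refine Fin.cases ?_ (fun j => ?_) j
        · simp
        · simpa using had j
      · refine Fin.cases ?_ (fun j => ?_) j
        · intro h; simp at h
        · simpa using hd i j
    · have h3 := hE.trans ⟨Matrix.fromBlocks 1 0 0 P, Matrix.fromBlocks 1 0 0 Q,
        Matrix.isUnit_fromBlocks_zero₁₂.2 ⟨isUnit_one, hP⟩,
        Matrix.isUnit_fromBlocks_zero₁₂.2 ⟨isUnit_one, hQ⟩, rfl⟩
      have h4 := h3.submatrix e.symm
      rw [Matrix.submatrix_submatrix, Matrix.fromBlocks_multiply, Matrix.fromBlocks_multiply] at h4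
      simp only [Equiv.self_comp_symm, Matrix.submatrix_id_id] at h4
      convert h4 using 1
      ext i j
      refine Fin.cases ?_ (fun i => ?_) i <;> refine Fin.cases ?_ (fun j => ?_) j
      · simp [he0]
      · simp [he0, hes, Fin.ext_iff]
      · simp [he0, hes, Fin.ext_iff]
      · simp [hes, hPQ, Matrix.diagonal_apply, Fin.ext_iff]

end UnimodularEquivalent

theorem exists_isSmithNormalForm {V : Type*} [Fintype V] [DecidableEq V] (M : Matrix V V ℤ) :
    ∃ d, IsSmithNormalForm M d := by
  let e := (Fintype.equivFin V).symm
  obtain ⟨d, hd, h⟩ := UnimodularEquivalent.exists_diagonal _ (M.submatrix e e)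
  obtain ⟨P, Q, hP, hQ, hPQ⟩ := h.submatrix e.symm
  refine ⟨d, hd, e, P, Q, hP, hQ, ?_⟩
  simp only [Matrix.submatrix_submatrix, Equiv.self_comp_symm, Matrix.submatrix_id_id] at hPQ
  rw [hPQ, Matrix.submatrix_submatrix]
  simp

/-! ### Invariant factors and rank modulo primes. -/

/-- `P` and `Q` stay invertible mod p, so only the diagonal matters; zero entries count as divisible
by p. -/
theorem rank_map_eq_of_isSmithNormalForm {V : Type*} [Fintype V] [DecidableEq V]
    {M : Matrix V V ℤ} {d : Fin (Fintype.card V) → ℕ} (h : IsSmithNormalForm M d)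
    (p : ℕ) [Fact p.Prime] :
    (M.map (Int.cast : ℤ → ZMod p)).rank =
      (Finset.univ.filter fun i => ¬ p ∣ d i).card := by
  obtain ⟨-, e, P, Q, hP, hQ, hPQ⟩ := h
  let φ := (Int.castRingHom (ZMod p)).mapMatrix (m := V)
  have h1 : (φ (P * M * Q)).submatrix e e = Matrix.diagonal fun i => (d i : ZMod p) := by
    have := congrArg (fun N => N.map (Int.cast : ℤ → ZMod p)) hPQ
    ext i j
    have := congrFun (congrFun this i) j
    by_cases hij : i = j
    · subst hij
      simpa [φ] using this
    · simpa [φ, hij] using this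
  have h2 := congrArg Matrix.rank h1
  rw [Matrix.rank_submatrix, map_mul, map_mul,
    Matrix.rank_mul_eq_left_of_isUnit_det _ _ ((Matrix.isUnit_iff_isUnit_det _).1 (hQ.map φ)),
    Matrix.rank_mul_eq_right_of_isUnit_det _ _ ((Matrix.isUnit_iff_isUnit_det _).1 (hP.map φ)),
    Matrix.rank_diagonal, Fintype.card_subtype] at h2
  rw [show M.map (Int.cast : ℤ → ZMod p) = φ M from rfl, h2]
  simp [ZMod.natCast_eq_zero_iff]

/-- At most `k` invariant factors are equal to `1` if and only if the rank modulo some prime is at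
most `k`. -/
theorem atMostInvariantFactorsOne_iff {V : Type*} [Fintype V] [DecidableEq V]
    (M : Matrix V V ℤ) (k : ℕ) :
    AtMostInvariantFactorsOne M k ↔
      ∃ p : ℕ, ∃ _ : Fact p.Prime, (M.map (Int.cast : ℤ → ZMod p)).rank ≤ k := by
  constructor
  · rintro ⟨d, hd, hk⟩
    by_cases hn : Fintype.card V ≤ k
    · exact ⟨2, ⟨Nat.prime_two⟩, (Matrix.rank_le_card_width _).trans hn⟩
    push Not at hn
    -- Indices start at 0: if this entry were 1, so would be all `k + 1` entries up to it.
    have hk1 : d ⟨k, hn⟩ ≠ 1 := fun h1 => by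
      have : (Finset.Iic (⟨k, hn⟩ : Fin (Fintype.card V))) ⊆ Finset.univ.filter fun i => d i = 1 := by
        intro i hi
        have := hd.1 i _ (Finset.mem_Iic.1 hi)
        rw [h1] at this
        simpa using this
      have := (Finset.card_le_card this).trans hk
      simp at this
    obtain ⟨p, hp, hpd⟩ := Nat.exists_prime_and_dvd hk1
    have : Fact p.Prime := ⟨hp⟩
    refine ⟨p, this, ?_⟩
    rw [rank_map_eq_of_isSmithNormalForm hd]
    calc _ ≤ (Finset.Iio (⟨k, hn⟩ : Fin (Fintype.card V))).card := by
          refine Finset.card_le_card fun i hi => ?_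
          rw [Finset.mem_filter] at hi
          rw [Finset.mem_Iio]
          by_contra hlt
          exact hi.2 (hpd.trans (hd.1 _ _ (not_lt.1 hlt)))
      _ = k := by simp
  · rintro ⟨p, hp, hr⟩
    obtain ⟨d, hd⟩ := exists_isSmithNormalForm M
    refine ⟨d, hd, le_trans (Finset.card_le_card fun i hi => ?_)
      ((rank_map_eq_of_isSmithNormalForm hd p).symm.trans_le hr)⟩
    rw [Finset.mem_filter] at hi ⊢
    exact ⟨hi.1, by rw [hi.2]; exact hp.out.not_dvd_one⟩

/-! ### Vanishing of 4×4 minors. -/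

open Matrix in
/-- All `4 × 4` minors of a matrix of rank at most three vanish. -/
theorem minor_eq_zero_of_rank_le_three {V F : Type*} [Fintype V] [Field F] {M : Matrix V V F}
    (h : M.rank ≤ 3) (r s : Fin 4 → V) : (M.submatrix r s).det = 0 := by
  by_contra hdet
  have h1 := rank_of_isUnit _ ((isUnit_iff_isUnit_det _).2 (isUnit_iff_ne_zero.2 hdet))
  have h2 := rank_submatrix_le M r s
  simp at h1
  omega

/-- Laplace expansion along the first two rows, which turns each vanishing minor into a polynomial
identity. -/
theorem det_fin_four {R : Type*} [CommRing R] (A : Matrix (Fin 4) (Fin 4) R) :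
    A.det = (A 0 0 * A 1 1 - A 0 1 * A 1 0) * (A 2 2 * A 3 3 - A 2 3 * A 3 2)
      - (A 0 0 * A 1 2 - A 0 2 * A 1 0) * (A 2 1 * A 3 3 - A 2 3 * A 3 1)
      + (A 0 0 * A 1 3 - A 0 3 * A 1 0) * (A 2 1 * A 3 2 - A 2 2 * A 3 1)
      + (A 0 1 * A 1 2 - A 0 2 * A 1 1) * (A 2 0 * A 3 3 - A 2 3 * A 3 0)
      - (A 0 1 * A 1 3 - A 0 3 * A 1 1) * (A 2 0 * A 3 2 - A 2 2 * A 3 0)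
      + (A 0 2 * A 1 3 - A 0 3 * A 1 2) * (A 2 0 * A 3 1 - A 2 1 * A 3 0) := by
  rw [Matrix.det_succ_row_zero]
  rw [Fin.sum_univ_four]
  simp only [Matrix.det_fin_three, Matrix.submatrix_apply]
  simp [show Fin.succAbove (1 : Fin 4) (1 : Fin 3) = 2 from rfl,
    show Fin.succAbove (1 : Fin 4) (2 : Fin 3) = 3 from rfl,
    show Fin.succAbove (2 : Fin 4) (1 : Fin 3) = 1 from rfl,
    show Fin.succAbove (2 : Fin 4) (2 : Fin 3) = 3 from rfl,
    show Fin.succAbove (3 : Fin 4) (1 : Fin 3) = 1 from rfl,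
    show Fin.succAbove (3 : Fin 4) (2 : Fin 3) = 2 from rfl]
  ring

/-! ### The matrix A + tI and the first forbidden configurations. -/

namespace SimpleGraph

variable {V F : Type*} [DecidableEq V] [Field F] (G : SimpleGraph V) [DecidableRel G.Adj]

/-- The adjacency matrix of `G` plus `t` times the identity matrix. -/
def shiftMatrix (t : F) : Matrix V V F :=
  fun v w => if v = w then t else if G.Adj v w then 1 else 0

variable {G} {t : F} {u v w x y : V}

@[simp]
theorem shiftMatrix_self : G.shiftMatrix t v v = t := by simp [shiftMatrix]

theorem shiftMatrix_of_adj (h : G.Adj v w) : G.shiftMatrix t v w = 1 := by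
  simp [shiftMatrix, h, h.ne]

theorem shiftMatrix_of_not_adj (hne : v ≠ w) (h : ¬ G.Adj v w) : G.shiftMatrix t v w = 0 := by
  simp [shiftMatrix, h, hne]

theorem shiftMatrix_comm : G.shiftMatrix t v w = G.shiftMatrix t w v := by
  simp [shiftMatrix, G.adj_comm, eq_comm]

theorem shiftMatrix_cases (hne : v ≠ w) :
    G.Adj v w ∧ G.shiftMatrix t v w = 1 ∨ ¬ G.Adj v w ∧ G.shiftMatrix t v w = 0 := by
  by_cases h : G.Adj v w
  · exact .inl ⟨h, shiftMatrix_of_adj h⟩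
  · exact .inr ⟨h, shiftMatrix_of_not_adj hne h⟩

theorem shiftMatrix_one_cases :
    (v = w ∨ G.Adj v w) ∧ G.shiftMatrix (1 : F) v w = 1 ∨
      ¬ (v = w ∨ G.Adj v w) ∧ G.shiftMatrix (1 : F) v w = 0 := by
  by_cases h : v = w
  · exact .inl ⟨.inl h, by simp [h]⟩
  · simpa [h] using shiftMatrix_cases (G := G) (t := (1 : F)) h

omit [DecidableEq V] [DecidableRel G.Adj] in
theorem Connected.mem_of_closed (hG : G.Connected) {S : Set V} (hu : u ∈ S)
    (hS : ∀ x ∈ S, ∀ y, G.Adj x y → y ∈ S) (v : V) : v ∈ S := by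
  obtain ⟨p⟩ := hG.preconnected u v
  induction p with
  | nil => exact hu
  | cons h _ ih => exact ih (hS _ hu _ h)

variable [Fintype V]

theorem minor_eq_zero (h : (G.shiftMatrix t).rank ≤ 3) (a b c d a' b' c' d' : V) :
    ((G.shiftMatrix t).submatrix ![a, b, c, d] ![a', b', c', d']).det = 0 :=
  minor_eq_zero_of_rank_le_three h _ _

theorem not_clique_five (h : (G.shiftMatrix t).rank ≤ 3) (ht : t ≠ 1) (f : Fin 5 → V)
    (hf : ∀ i j, i ≠ j → G.Adj (f i) (f j)) : False := by
  -- Replacing one column of the principal minor by that of the fifth vertex gives the determinant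
  -- (t - 1)³.
  have hm := minor_eq_zero h (f 0) (f 1) (f 2) (f 3) (f 0) (f 1) (f 2) (f 4)
  have hv : ∀ i j, i ≠ j → G.shiftMatrix t (f i) (f j) = 1 := fun i j hij =>
    shiftMatrix_of_adj (hf i j hij)
  rw [det_fin_four] at hm
  simp [hv] at hm
  have : (t - 1) ^ 3 = 0 := by linear_combination hm
  exact ht (sub_eq_zero.1 (pow_eq_zero_iff three_ne_zero |>.1 this))

/-- A neighbour x of v exists by connectedness, and the minor on u, w, v, x is 1 whether or not x is
adjacent to u or w. -/
theorem not_adj_trans_of_shift_zero (hG : G.Connected) (h : (G.shiftMatrix (0 : F)).rank ≤ 3)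
    (huv : ¬ G.Adj u v) (hvw : ¬ G.Adj v w) : ¬ G.Adj u w := by
  intro huw
  have hne : u ≠ v := by rintro rfl; exact hvw huw
  have hne' : v ≠ w := by rintro rfl; exact huv huw
  have : Nontrivial V := ⟨u, v, hne⟩
  obtain ⟨x, hx⟩ := (G.degree_pos_iff_exists_adj v).1 (hG.preconnected.degree_pos_of_nontrivial v)
  have hm := minor_eq_zero h u w v x u w v x
  rw [det_fin_four] at hm
  simp [shiftMatrix_of_adj huw, shiftMatrix_of_adj huw.symm, shiftMatrix_of_adj hx,
    shiftMatrix_of_adj hx.symm, shiftMatrix_of_not_adj hne huv,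
    shiftMatrix_of_not_adj hne.symm (fun h => huv h.symm), shiftMatrix_of_not_adj hne' hvw,
    shiftMatrix_of_not_adj hne'.symm (fun h => hvw h.symm)] at hm

-- Without such a path every closed neighbourhood is closed under adjacency, hence is everything.
omit [DecidableEq V] [DecidableRel G.Adj] [Fintype V] in
theorem Connected.exists_induced_path (hG : G.Connected) (htop : G ≠ ⊤) :
    ∃ a b c, G.Adj a b ∧ G.Adj b c ∧ a ≠ c ∧ ¬ G.Adj a c := by
  by_contra! hcon
  refine htop ?_
  ext a b
  refine ⟨fun h => h.ne, fun hab => ?_⟩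
  have := hG.mem_of_closed (u := a) (S := {x | a = x ∨ G.Adj a x}) (.inl rfl) (by
    rintro x (rfl | hx) y hxy
    · exact .inr hxy
    · by_cases hay : a = y
      · exact .inl hay
      · exact .inr (hcon a x y hx hxy hay)) b
  exact this.resolve_left hab

omit [DecidableEq V] in
theorem IsRegularOfDegree.card_not_adj {k : ℕ} (hk : G.IsRegularOfDegree k) (v : V) :
    (Finset.univ.filter fun w => ¬ G.Adj v w).card = Fintype.card V - k := by
  have h := Finset.card_filter_add_card_filter_not (s := Finset.univ) (fun w => G.Adj v w)
  have h1 : (Finset.univ.filter fun w => G.Adj v w).card = k := by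
    rw [← hk v, degree, neighborFinset_eq_filter]
  rw [h1, Finset.card_univ] at h
  omega

theorem IsRegularOfDegree.card_ne_not_adj {k : ℕ} (hk : G.IsRegularOfDegree k) (v : V) :
    (Finset.univ.filter fun w => ¬ (v = w ∨ G.Adj v w)).card = Fintype.card V - k - 1 := by
  rw [← hk.card_not_adj v, ← Finset.card_erase_of_mem (a := v) (by simp)]
  congr 1
  ext w
  simp [eq_comm]

/-! ### The case t = 1: blow-ups of the 4-cycle. -/

theorem shift_one_classification (hG : G.Connected) {k : ℕ} (hk : G.IsRegularOfDegree k)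
    (htop : G ≠ ⊤) (h : (G.shiftMatrix (1 : F)).rank ≤ 3) :
    ∃ r : ℕ, 1 ≤ r ∧ ∃ f : V → Fin 4, (∀ i, (Finset.univ.filter fun v => f v = i).card = r) ∧
      ∀ v w, (v = w ∨ G.Adj v w) ↔ (f v = f w ∨ (cycleGraph 4).Adj (f v) (f w)) := by
  obtain ⟨a, b, c, hab, hbc, hne, hac⟩ := hG.exists_induced_path htop
  -- The block on a, b, c has determinant -1; bordering it by v and w expresses every entry through
  -- its inverse.
  have key : ∀ v w, G.shiftMatrix (1 : F) v w =
      G.shiftMatrix 1 v a * (G.shiftMatrix 1 w b - G.shiftMatrix 1 w c) +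
      G.shiftMatrix 1 v b * (G.shiftMatrix 1 w a - G.shiftMatrix 1 w b + G.shiftMatrix 1 w c) +
      G.shiftMatrix 1 v c * (G.shiftMatrix 1 w b - G.shiftMatrix 1 w a) := by
    intro v w
    have hm := minor_eq_zero h a b c v a b c w
    rw [det_fin_four] at hm
    simp [shiftMatrix_of_adj hab, shiftMatrix_of_adj hab.symm, shiftMatrix_of_adj hbc,
      shiftMatrix_of_adj hbc.symm, shiftMatrix_of_not_adj hne hac,
      shiftMatrix_of_not_adj hne.symm (fun h => hac h.symm)] at hm
    rw [shiftMatrix_comm (v := w) (w := a), shiftMatrix_comm (v := w) (w := b),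
      shiftMatrix_comm (v := w) (w := c)]
    linear_combination -hm
  -- If b were adjacent to all other vertices, regularity would give the same for a, yet a and c are
  -- nonadjacent.
  obtain ⟨d, hd⟩ : ∃ d, ¬ (d = b ∨ G.Adj d b) := by
    by_contra! hcon
    have h1 := hk.card_ne_not_adj b
    have h2 := hk.card_ne_not_adj a
    rw [Finset.filter_false_of_mem (by
      intro x _ hx; rw [eq_comm, G.adj_comm] at hx; exact hx (hcon x)), Finset.card_empty] at h1
    rw [← h1, Finset.card_eq_zero, Finset.filter_eq_empty_iff] at h2
    have := h2 (Finset.mem_univ c)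
    tauto
  have hself := fun v => key v v
  simp only [shiftMatrix_self] at hself
  have h3 : (3 : F) = 0 ∧ (d = a ∨ G.Adj d a) ∧ (d = c ∨ G.Adj d c) := by
    have hdd := hself d
    have e2 := (shiftMatrix_one_cases (F := F) (G := G) (v := d) (w := b)).resolve_left
      (fun h => hd h.1)
    rcases shiftMatrix_one_cases (F := F) (G := G) (v := d) (w := a) with ⟨h1, e1⟩ | ⟨h1, e1⟩ <;>
    rcases shiftMatrix_one_cases (F := F) (G := G) (v := d) (w := c) with ⟨h3, e3⟩ | ⟨h3, e3⟩ <;>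
    simp [e1, e2.2, e3] at hdd
    refine ⟨by linear_combination hdd, h1, h3⟩
  obtain ⟨h3, hda, hdc⟩ := h3
  -- The diagonal identity in characteristic 3 lets a vertex miss at most one of a, b, c. The labels
  -- put a, b, c, d in classes 0, 1, 2, 3 in cyclic order, so that only opposite classes are
  -- nonadjacent.
  let f : V → Fin 4 := fun v =>
    if ¬ (v = a ∨ G.Adj v a) then 2 else if ¬ (v = b ∨ G.Adj v b) then 3 else
      if ¬ (v = c ∨ G.Adj v c) then 0 else 1
  have hf : ∀ v, f v = 0 ∧ G.shiftMatrix (1 : F) v a = 1 ∧ G.shiftMatrix (1 : F) v b = 1 ∧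
        G.shiftMatrix (1 : F) v c = 0 ∨
      f v = 1 ∧ G.shiftMatrix (1 : F) v a = 1 ∧ G.shiftMatrix (1 : F) v b = 1 ∧
        G.shiftMatrix (1 : F) v c = 1 ∨
      f v = 2 ∧ G.shiftMatrix (1 : F) v a = 0 ∧ G.shiftMatrix (1 : F) v b = 1 ∧
        G.shiftMatrix (1 : F) v c = 1 ∨
      f v = 3 ∧ G.shiftMatrix (1 : F) v a = 1 ∧ G.shiftMatrix (1 : F) v b = 0 ∧
        G.shiftMatrix (1 : F) v c = 1 := by
    intro v
    have hv := hself v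
    have h10 : (1 : F) ≠ 0 := one_ne_zero
    rcases shiftMatrix_one_cases (F := F) (G := G) (v := v) (w := a) with ⟨h1, e1⟩ | ⟨h1, e1⟩ <;>
    rcases shiftMatrix_one_cases (F := F) (G := G) (v := v) (w := b) with ⟨h2, e2⟩ | ⟨h2, e2⟩ <;>
    rcases shiftMatrix_one_cases (F := F) (G := G) (v := v) (w := c) with ⟨h4, e3⟩ | ⟨h4, e3⟩ <;>
    simp [e1, e2, e3] at hv <;> simp only [e1, e2, e3, f, h1, h2, h4] <;> simp
    exact h10 (by linear_combination h3 - hv)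
  have hadj : ∀ v w, (v = w ∨ G.Adj v w) ↔ f w ≠ f v + 2 := by
    intro v w
    have hvw := key v w
    have h10 : (1 : F) ≠ 0 := one_ne_zero
    have hM : (v = w ∨ G.Adj v w) ↔ G.shiftMatrix (1 : F) v w ≠ 0 := by
      rcases shiftMatrix_one_cases (F := F) (G := G) (v := v) (w := w) with ⟨h1, e1⟩ | ⟨h1, e1⟩ <;>
      simp [h1, e1]
    rw [hM]
    rcases hf v with ⟨e0, e1, e2, e3⟩ | ⟨e0, e1, e2, e3⟩ | ⟨e0, e1, e2, e3⟩ | ⟨e0, e1, e2, e3⟩ <;>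
    rcases hf w with ⟨e0', e1', e2', e3'⟩ | ⟨e0', e1', e2', e3'⟩ | ⟨e0', e1', e2', e3'⟩ |
      ⟨e0', e1', e2', e3'⟩ <;>
    rw [e1, e2, e3, e1', e2', e3'] at hvw <;> rw [e0, e0', hvw] <;> ring_nf <;> simp
    all_goals grind
  -- The shift by 2 serves the count below: class i is the set of non-neighbours of a vertex in the
  -- opposite class.
  have hsurj : ∀ i, ∃ v, f v = i + 2 := by
    have hfa : f a = 0 := by simp [f, hab, hne, hac]
    have hfb : f b = 1 := by simp [f, hab.symm, hbc]
    have hfc : f c = 2 := by simp [f, hne.symm, G.adj_comm c a, hac]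
    have hfd : f d = 3 := by simp only [f, hda, hd]; simp
    intro i
    fin_cases i
    exacts [⟨c, hfc⟩, ⟨d, hfd⟩, ⟨a, hfa⟩, ⟨b, hfb⟩]
  have hcard : ∀ i, (Finset.univ.filter fun v => f v = i).card = Fintype.card V - k - 1 := by
    intro i
    obtain ⟨v, hv⟩ := hsurj i
    rw [← hk.card_ne_not_adj v]
    congr 1
    ext w
    rw [Finset.mem_filter, Finset.mem_filter, hadj, hv, not_not, add_assoc,
      show (2 : Fin 4) + 2 = 0 from rfl, add_zero]
  refine ⟨_, ?_, f, hcard, fun v w => ?_⟩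
  · rw [← hcard 0, Nat.one_le_iff_ne_zero, ← Nat.pos_iff_ne_zero, Finset.card_pos]
    obtain ⟨v, hv⟩ := hsurj 2
    exact ⟨v, by simpa using hv⟩
  · rw [hadj]
    generalize f v = i
    generalize f w = j
    revert i j
    decide

end SimpleGraph

/-! ### The case t ≠ 0, 1 in characteristic other than 2: the pentagon and the prism. -/

namespace SimpleGraph

variable {V F : Type*} [DecidableEq V] [Field F] {G : SimpleGraph V} [DecidableRel G.Adj]
  {t : F} {u v w x y : V} [Fintype V]

omit [DecidableEq V] in
theorem IsRegularOfDegree.exists_adj_not_adj {k : ℕ} (hk : G.IsRegularOfDegree k)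
    (hw : G.Adj u w) (hvw : ¬ G.Adj v w) : ∃ z, G.Adj v z ∧ ¬ G.Adj u z := by
  by_contra! hcon
  have h1 : G.neighborFinset v ⊂ G.neighborFinset u :=
    (Finset.ssubset_iff_of_subset fun z hz => by simpa using hcon z (by simpa using hz)).2
      ⟨w, by simpa, by simpa⟩
  have h2 := Finset.card_lt_card h1
  rw [card_neighborFinset_eq_degree, card_neighborFinset_eq_degree, hk, hk] at h2
  exact lt_irrefl _ h2

/-- Equal degrees make the two differences of neighbourhoods equal in size. -/
theorem IsRegularOfDegree.exists_second_adj_not_adj {k : ℕ} (hk : G.IsRegularOfDegree k)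
    (hx : G.Adj v x ∧ ¬ G.Adj u x) (hy : G.Adj v y ∧ ¬ G.Adj u y) (hxy : x ≠ y) (w : V) :
    ∃ z, z ≠ w ∧ G.Adj u z ∧ ¬ G.Adj v z := by
  by_contra! hcon
  have h1 := Finset.card_sdiff_comm (s := G.neighborFinset u) (t := G.neighborFinset v)
    (by rw [card_neighborFinset_eq_degree, card_neighborFinset_eq_degree, hk, hk])
  have h2 : G.neighborFinset u \ G.neighborFinset v ⊆ {w} := fun z hz => by
    rw [Finset.mem_sdiff, mem_neighborFinset, mem_neighborFinset] at hz
    rw [Finset.mem_singleton]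
    by_contra hzw
    exact hz.2 (hcon z hzw hz.1)
  have h3 : {x, y} ⊆ G.neighborFinset v \ G.neighborFinset u := by
    intro z hz
    rw [Finset.mem_insert, Finset.mem_singleton] at hz
    rw [Finset.mem_sdiff, mem_neighborFinset, mem_neighborFinset]
    rcases hz with rfl | rfl
    exacts [hx, hy]
  have h4 := Finset.card_le_card h2
  have h5 := Finset.card_le_card h3
  rw [Finset.card_pair hxy] at h5
  rw [Finset.card_singleton] at h4
  omega

/-- The block on a, b, c is tI, so t times any entry is a sum of three products. Two neighbours of a
contradict this, so the degree is 1, and a connected graph of degree 1 has no room for b. -/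
theorem not_indep_three (hG : G.Connected) {k : ℕ} (hk : G.IsRegularOfDegree k)
    (h : (G.shiftMatrix t).rank ≤ 3) (h0 : t ≠ 0) (h1 : t ≠ 1) (h2 : (2 : F) ≠ 0) {a b c : V}
    (hab : a ≠ b) (hac : a ≠ c) (hbc : b ≠ c) (nab : ¬ G.Adj a b) (nac : ¬ G.Adj a c)
    (nbc : ¬ G.Adj b c) : False := by
  have nba : ¬ G.Adj b a := fun h => nab h.symm
  have nca : ¬ G.Adj c a := fun h => nac h.symm
  have ncb : ¬ G.Adj c b := fun h => nbc h.symm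
  have key : ∀ v w, t * G.shiftMatrix t v w = G.shiftMatrix t a v * G.shiftMatrix t a w +
      G.shiftMatrix t b v * G.shiftMatrix t b w + G.shiftMatrix t c v * G.shiftMatrix t c w := by
    intro v w
    have hm := minor_eq_zero h a b c v a b c w
    rw [det_fin_four] at hm
    simp [shiftMatrix_of_not_adj hab nab, shiftMatrix_of_not_adj hac nac,
      shiftMatrix_of_not_adj hbc nbc, shiftMatrix_of_not_adj hab.symm nba,
      shiftMatrix_of_not_adj hac.symm nca, shiftMatrix_of_not_adj hbc.symm ncb] at hm
    rw [shiftMatrix_comm (v := v) (w := a), shiftMatrix_comm (v := v) (w := b),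
      shiftMatrix_comm (v := v) (w := c)] at hm
    refine mul_left_cancel₀ (pow_ne_zero 2 h0) ?_
    linear_combination hm
  have htt : t * t ≠ t := fun h => h1 (mul_left_cancel₀ h0 (h.trans (mul_one t).symm))
  have huniq : ∀ v w, G.Adj a v → G.Adj a w → v = w := by
    intro v w hv hw
    by_contra hvw
    have kv := key v v
    have kw := key w w
    have kvw := key v w
    have hbv : b ≠ v := by rintro rfl; exact nab hv
    have hcv : c ≠ v := by rintro rfl; exact nac hv
    have hbw : b ≠ w := by rintro rfl; exact nab hw
    have hcw : c ≠ w := by rintro rfl; exact nac hw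
    rw [shiftMatrix_self, shiftMatrix_of_adj hv] at kv
    rw [shiftMatrix_self, shiftMatrix_of_adj hw] at kw
    rw [shiftMatrix_of_adj hv, shiftMatrix_of_adj hw] at kvw
    rcases shiftMatrix_cases (G := G) (t := t) hbv with ⟨-, e1⟩ | ⟨-, e1⟩ <;>
    rcases shiftMatrix_cases (G := G) (t := t) hcv with ⟨-, e2⟩ | ⟨-, e2⟩ <;>
    rcases shiftMatrix_cases (G := G) (t := t) hbw with ⟨-, e3⟩ | ⟨-, e3⟩ <;>
    rcases shiftMatrix_cases (G := G) (t := t) hcw with ⟨-, e4⟩ | ⟨-, e4⟩ <;>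
    rcases shiftMatrix_cases (G := G) (t := t) hvw with ⟨-, e5⟩ | ⟨-, e5⟩ <;>
    rw [e1, e2] at kv <;> rw [e3, e4] at kw <;> rw [e1, e2, e3, e4, e5] at kvw <;>
    clear e1 e2 e3 e4 e5 key <;> grind
  have : Nontrivial V := ⟨a, b, hab⟩
  obtain ⟨v, hv⟩ := (G.degree_pos_iff_exists_adj a).1 (hG.preconnected.degree_pos_of_nontrivial a)
  have huniq' : ∀ w, G.Adj v w → w = a := by
    intro w hw
    by_contra hwa
    have hav : G.degree a = G.degree v := by rw [hk, hk]
    have h3 : G.degree a ≤ 1 := by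
      rw [← card_neighborFinset_eq_degree, Finset.card_le_one]
      intro x hx y hy
      exact huniq x y (by simpa using hx) (by simpa using hy)
    rw [hav, ← card_neighborFinset_eq_degree, Finset.card_le_one] at h3
    exact hwa (h3 w (by simpa using hw) a (by simpa using hv.symm))
  have := hG.mem_of_closed (u := a) (S := {a, v}) (by simp) (by
    rintro x (rfl | rfl) y hxy
    · exact .inr (huniq _ _ hxy hv)
    · exact .inl (huniq' _ hxy)) b
  rcases this with rfl | rfl
  · exact hab rfl
  · exact nab hv

omit [DecidableEq V] [Field F] [DecidableRel G.Adj] [Fintype V] in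
theorem nonempty_iso_of_map {W : Type*} {H : SimpleGraph W} (g : W → V)
    (hinj : Function.Injective g) (hsurj : Function.Surjective g)
    (hadj : ∀ i j, H.Adj i j ↔ G.Adj (g i) (g j)) : Nonempty (G ≃g H) :=
  ⟨(RelIso.symm ⟨Equiv.ofBijective g ⟨hinj, hsurj⟩, fun {i j} => (hadj i j).symm⟩)⟩

omit [DecidableEq V] [Field F] [DecidableRel G.Adj] [Fintype V] in
theorem nonempty_iso_cycleGraph_five {a b c d e : V} (hall : ∀ s, s = a ∨ s = b ∨ s = c ∨ s = d ∨ s = e)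
    (ab : G.Adj a b) (bc : G.Adj b c) (cd : G.Adj c d) (de : G.Adj d e) (ea : G.Adj e a)
    (ac : ¬ G.Adj a c) (ad : ¬ G.Adj a d) (bd : ¬ G.Adj b d) (be : ¬ G.Adj b e)
    (ce : ¬ G.Adj c e) : Nonempty (G ≃g cycleGraph 5) := by
  have hadj : ∀ i j, (cycleGraph 5).Adj i j ↔ G.Adj (![a, b, c, d, e] i) (![a, b, c, d, e] j) := by
    intro i j
    fin_cases i <;> fin_cases j <;>
      simp [ab, bc, cd, de, ea, ac, ad, bd, be, ce, ab.symm, bc.symm, cd.symm, de.symm, ea.symm,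
        G.adj_comm c a, G.adj_comm d a, G.adj_comm d b, G.adj_comm e b, G.adj_comm e c] <;> decide
  refine nonempty_iso_of_map ![a, b, c, d, e] (fun i j hij => ?_) (fun s => ?_) hadj
  -- Injectivity is free: distinct vertices of C_5 have distinct neighbourhoods. The prism shares
  -- this property.
  · have h1 : ∀ l, (cycleGraph 5).Adj i l ↔ (cycleGraph 5).Adj j l := fun l => by
      rw [hadj, hadj, hij]
    clear hij hadj
    revert i j
    decide
  · rcases hall s with rfl | rfl | rfl | rfl | rfl
    exacts [⟨0, rfl⟩, ⟨1, rfl⟩, ⟨2, rfl⟩, ⟨3, rfl⟩, ⟨4, rfl⟩]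

omit [DecidableEq V] [Field F] [DecidableRel G.Adj] [Fintype V] in
theorem nonempty_iso_prism {a b c d e f : V}
    (hall : ∀ s, s = a ∨ s = b ∨ s = c ∨ s = d ∨ s = e ∨ s = f)
    (ab : G.Adj a b) (bc : G.Adj b c) (ac : G.Adj a c) (de : G.Adj d e) (ef : G.Adj e f)
    (df : G.Adj d f) (ad : G.Adj a d) (be : G.Adj b e) (cf : G.Adj c f)
    (ae : ¬ G.Adj a e) (af : ¬ G.Adj a f) (bd : ¬ G.Adj b d) (bf : ¬ G.Adj b f)
    (cd : ¬ G.Adj c d) (ce : ¬ G.Adj c e) :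
    Nonempty (G ≃g (completeGraph (Fin 3)).boxProd (completeGraph (Fin 2))) := by
  let g : Fin 3 × Fin 2 → V := fun x => ![![a, b, c], ![d, e, f]] x.2 x.1
  have hadj : ∀ i j, ((completeGraph (Fin 3)).boxProd (completeGraph (Fin 2))).Adj i j ↔
      G.Adj (g i) (g j) := by
    rintro ⟨i, i'⟩ ⟨j, j'⟩
    fin_cases i <;> fin_cases j <;> fin_cases i' <;> fin_cases j' <;>
      simp [g, boxProd_adj, ab, bc, ac, de, ef, df, ad, be, cf, ae, af, bd, bf, cd, ce, ab.symm,
        bc.symm, ac.symm, de.symm, ef.symm, df.symm, ad.symm, be.symm, cf.symm, G.adj_comm e a,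
        G.adj_comm f a, G.adj_comm d b, G.adj_comm f b, G.adj_comm d c, G.adj_comm e c]
  refine nonempty_iso_of_map g (fun i j hij => ?_) (fun s => ?_) hadj
  · have h1 : ∀ l, ((completeGraph (Fin 3)).boxProd (completeGraph (Fin 2))).Adj i l ↔
        ((completeGraph (Fin 3)).boxProd (completeGraph (Fin 2))).Adj j l := fun l => by
      rw [hadj, hadj, hij]
    clear hij hadj
    simp only [boxProd_adj, completeGraph_eq_top, top_adj] at h1
    revert i j
    decide
  · rcases hall s with rfl | rfl | rfl | rfl | rfl | rfl
    exacts [⟨(0, 0), rfl⟩, ⟨(1, 0), rfl⟩, ⟨(2, 0), rfl⟩, ⟨(0, 1), rfl⟩, ⟨(1, 1), rfl⟩,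
      ⟨(2, 1), rfl⟩]

/-- The Schur complement with respect to two nonadjacent vertices has rank at most one. -/
theorem schur_rank_one (h : (G.shiftMatrix t).rank ≤ 3) (huv : u ≠ v)
    (nuv : ¬ G.Adj u v) (x x' y y' : V) :
    (t * G.shiftMatrix t x x' - G.shiftMatrix t u x * G.shiftMatrix t u x' -
        G.shiftMatrix t v x * G.shiftMatrix t v x') *
      (t * G.shiftMatrix t y y' - G.shiftMatrix t u y * G.shiftMatrix t u y' -
        G.shiftMatrix t v y * G.shiftMatrix t v y') =
    (t * G.shiftMatrix t x y' - G.shiftMatrix t u x * G.shiftMatrix t u y' -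
        G.shiftMatrix t v x * G.shiftMatrix t v y') *
      (t * G.shiftMatrix t y x' - G.shiftMatrix t u y * G.shiftMatrix t u x' -
        G.shiftMatrix t v y * G.shiftMatrix t v x') := by
  have hm := minor_eq_zero h u v x y u v x' y'
  rw [det_fin_four] at hm
  simp [shiftMatrix_of_not_adj huv nuv,
    shiftMatrix_of_not_adj huv.symm (fun h => nuv h.symm)] at hm
  rw [shiftMatrix_comm (v := x) (w := u), shiftMatrix_comm (v := x) (w := v),
    shiftMatrix_comm (v := y) (w := u), shiftMatrix_comm (v := y) (w := v)] at hm
  linear_combination hm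

/-- A vertex adjacent to `u` but not to `v` is unique. -/
theorem private_neighbor_unique (hG : G.Connected) {k : ℕ} (hk : G.IsRegularOfDegree k)
    (h : (G.shiftMatrix t).rank ≤ 3) (h0 : t ≠ 0) (h1 : t ≠ 1) (h2 : (2 : F) ≠ 0) (huv : u ≠ v)
    (nuv : ¬ G.Adj u v) {w w' : V} (uw : G.Adj u w) (vw : ¬ G.Adj v w) (uw' : G.Adj u w')
    (vw' : ¬ G.Adj v w') : w = w' := by
  by_contra hww
  have hvw : v ≠ w := by rintro rfl; exact nuv uw
  have hvw' : v ≠ w' := by rintro rfl; exact nuv uw'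
  have ww' : G.Adj w w' := by
    by_contra hn
    exact not_indep_three hG hk h h0 h1 h2 hvw hvw' hww vw vw' hn
  obtain ⟨z, vz, uz⟩ := hk.exists_adj_not_adj uw vw
  have hwz : w ≠ z := by rintro rfl; exact vw vz
  have hwz' : w' ≠ z := by rintro rfl; exact vw' vz
  have huz : u ≠ z := by rintro rfl; exact nuv vz.symm
  have s1 := schur_rank_one h huv nuv w w w' w'
  have s2 := schur_rank_one h huv nuv w w w' z
  have s3 := schur_rank_one h huv nuv w w z z
  simp only [shiftMatrix_self, shiftMatrix_of_adj uw, shiftMatrix_of_adj uw',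
    shiftMatrix_of_not_adj hvw vw, shiftMatrix_of_not_adj hvw' vw', shiftMatrix_of_adj vz,
    shiftMatrix_of_not_adj huz uz, shiftMatrix_of_adj ww', shiftMatrix_of_adj ww'.symm,
    shiftMatrix_comm (v := z) (w := w)] at s1 s2 s3
  have ht : t = -2 := by
    have : t * (t - 1) ^ 2 * (t + 2) = 0 := by linear_combination s1
    have h1' := sub_ne_zero.2 h1
    simp [h0, h1'] at this
    linear_combination this
  have h3 : (3 : F) ≠ 0 := fun h3 => h1 (by linear_combination ht - h3)
  -- With t = -2, `s2` makes z nonadjacent to both w and w'; then `s3` reads 9 = 0.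
  rcases shiftMatrix_cases (G := G) (t := t) hwz with ⟨-, e⟩ | ⟨-, e⟩ <;>
  rcases shiftMatrix_cases (G := G) (t := t) hwz' with ⟨-, e'⟩ | ⟨-, e'⟩ <;>
  rw [e] at s2 s3 <;> rw [e'] at s2 <;> subst ht <;> clear s1 e e' <;>
  first
  | exact h3 (mul_self_eq_zero.1 (by linear_combination s3))
  | grind

set_option maxHeartbeats 1000000 in
theorem shift_generic_classification (hG : G.Connected) {k : ℕ} (hk : G.IsRegularOfDegree k)
    (h : (G.shiftMatrix t).rank ≤ 3) (h0 : t ≠ 0) (h1 : t ≠ 1) (h2 : (2 : F) ≠ 0) (huv : u ≠ v)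
    (nuv : ¬ G.Adj u v) (uw : G.Adj u w) (vw : ¬ G.Adj v w) :
    Nonempty (G ≃g cycleGraph 5) ∨
      Nonempty (G ≃g (completeGraph (Fin 3)).boxProd (completeGraph (Fin 2))) := by
  obtain ⟨z, vz, uz⟩ := hk.exists_adj_not_adj uw vw
  have huz : u ≠ z := by rintro rfl; exact nuv vz.symm
  have hvw : v ≠ w := by rintro rfl; exact nuv uw
  have hwz : w ≠ z := by rintro rfl; exact vw vz
  have nvu : ¬ G.Adj v u := fun h => nuv h.symm
  have uniq_w : ∀ x, G.Adj u x → ¬ G.Adj v x → x = w := fun x ux vx =>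
    private_neighbor_unique hG hk h h0 h1 h2 huv nuv ux vx uw vw
  have uniq_z : ∀ x, G.Adj v x → ¬ G.Adj u x → x = z := fun x vx ux =>
    private_neighbor_unique hG hk h h0 h1 h2 huv.symm nvu vx ux vz uz
  have hall : ∀ x, x = u ∨ x = v ∨ x = w ∨ x = z ∨ G.Adj u x ∧ G.Adj v x := by
    intro x
    by_cases hxu : x = u
    · exact .inl hxu
    by_cases hxv : x = v
    · exact .inr (.inl hxv)
    by_cases ux : G.Adj u x
    · by_cases vx : G.Adj v x
      · tauto
      · have := uniq_w x ux vx; tauto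
    · by_cases vx : G.Adj v x
      · have := uniq_z x vx ux; tauto
      · exact (not_indep_three hG hk h h0 h1 h2 huv (Ne.symm hxu) (Ne.symm hxv) nuv ux vx).elim
  have hcne : ∀ {x}, G.Adj u x ∧ G.Adj v x → w ≠ x ∧ z ≠ x := fun {x} hx =>
    ⟨by rintro rfl; exact vw hx.2, by rintro rfl; exact uz hx.1⟩
  have muw := shiftMatrix_of_adj (t := t) uw
  have mvw := shiftMatrix_of_not_adj (t := t) hvw vw
  have mvz := shiftMatrix_of_adj (t := t) vz
  have muz := shiftMatrix_of_not_adj (t := t) huz uz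
  have S := schur_rank_one h huv nuv
  -- If w and z were nonadjacent, t² = 1 would exclude common neighbours of u and v, and {u, w}
  -- would be a component.
  have wz : G.Adj w z := by
    by_contra nwz
    have mwz := shiftMatrix_of_not_adj (t := t) hwz nwz
    have mzw := shiftMatrix_comm (G := G) (t := t) (v := z) (w := w)
    have s1 := S w w z z
    simp only [shiftMatrix_self, muw, mvw, mvz, muz, mwz, mzw] at s1
    have hc : ∀ x, ¬ (G.Adj u x ∧ G.Adj v x) := by
      rintro x ⟨ux, vx⟩
      have s2 := S w w x x
      have mxw := shiftMatrix_comm (G := G) (t := t) (v := x) (w := w)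
      have mux := shiftMatrix_of_adj (t := t) ux
      have mvx := shiftMatrix_of_adj (t := t) vx
      simp only [shiftMatrix_self, muw, mvw, mux, mvx, mxw] at s2
      rcases shiftMatrix_cases (G := G) (t := t) (hcne ⟨ux, vx⟩).1 with ⟨-, e⟩ | ⟨-, e⟩ <;>
      rw [e] at s2 <;> grind
    have := hG.mem_of_closed (u := u) (S := {u, w}) (by simp) (by
      rintro x (rfl | rfl) y hxy
      · by_cases hy : G.Adj v y
        · exact (hc y ⟨hxy, hy⟩).elim
        · exact .inr (uniq_w y hxy hy)
      · rcases hall y with rfl | rfl | rfl | rfl | hy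
        · simp
        · exact (vw hxy.symm).elim
        · simp
        · exact (nwz hxy).elim
        · exact (hc y hy).elim) v
    rcases this with rfl | rfl
    · exact huv rfl
    · exact hvw rfl
  have mwz := shiftMatrix_of_adj (t := t) wz
  have mzw := shiftMatrix_of_adj (t := t) wz.symm
  have s1 := S w w z z
  simp only [shiftMatrix_self, muw, mvw, mvz, muz, mwz, mzw] at s1
  -- Both u and z are neighbours of w outside the neighbourhood of u, so u has a neighbour other
  -- than w that is not adjacent to w.
  obtain ⟨c, hcw, uc, wc⟩ := hk.exists_second_adj_not_adj (v := w) (u := u) (x := u) (y := z)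
    ⟨uw.symm, G.irrefl⟩ ⟨wz, uz⟩ huz w
  have vc : G.Adj v c := by
    by_contra vc
    exact hcw (uniq_w c uc vc)
  have hcw := (hcne ⟨uc, vc⟩).1
  have hcz := (hcne ⟨uc, vc⟩).2
  have muc := shiftMatrix_of_adj (t := t) uc
  have mvc := shiftMatrix_of_adj (t := t) vc
  have mwc := shiftMatrix_of_not_adj (t := t) hcw wc
  have s2 := S w w z c
  simp only [shiftMatrix_self, muw, mvw, mvz, muz, mzw, muc, mvc, mwc] at s2
  have s1' : (t ^ 2 - 1 - t) * (t ^ 2 - 1 + t) = 0 := by linear_combination s1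
  -- If t² - 1 = t, then `s2` makes z and c nonadjacent, which closes a pentagon. If t² - 1 = -t, it
  -- makes them adjacent with t = 2, so 5 = 0.
  rcases mul_eq_zero.1 s1' with ht | ht
  · have nzc : ¬ G.Adj z c := by
      intro zc
      rw [shiftMatrix_of_adj zc] at s2
      grind
    have huniq : ∀ x, G.Adj u x ∧ G.Adj v x → x = c := by
      rintro x ⟨ux, vx⟩
      by_contra hxc
      have s3 := S w w z x
      have s4 := S w w x x
      have s5 := S w x c w
      have mux := shiftMatrix_of_adj (t := t) ux
      have mvx := shiftMatrix_of_adj (t := t) vx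
      have mcw := shiftMatrix_of_not_adj (t := t) hcw.symm (fun h => wc h.symm)
      have mxw := shiftMatrix_comm (G := G) (t := t) (v := x) (w := w)
      simp only [shiftMatrix_self, muw, mvw, mvz, muz, mzw, mux, mvx, muc, mvc, mcw, mxw]
        at s3 s4 s5
      rcases shiftMatrix_cases (G := G) (t := t) (hcne ⟨ux, vx⟩).1 with ⟨-, e1⟩ | ⟨-, e1⟩ <;>
      rcases shiftMatrix_cases (G := G) (t := t) (hcne ⟨ux, vx⟩).2 with ⟨-, e2⟩ | ⟨-, e2⟩ <;>
      rcases shiftMatrix_cases (G := G) (t := t) (Ne.symm hxc) with ⟨-, e3⟩ | ⟨-, e3⟩ <;>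
      rw [e1] at s3 s4 s5 <;> rw [e2] at s3 <;> rw [e3] at s5 <;> clear e1 e2 e3 <;> grind
    left
    refine nonempty_iso_cycleGraph_five (a := u) (b := w) (c := z) (d := v) (e := c) ?_ uw wz
      vz.symm vc uc.symm uz nuv (fun h => vw h.symm) wc nzc
    intro s
    have := hall s
    have := huniq s
    tauto
  · have h5 : t = 2 ∧ (5 : F) = 0 ∧ G.Adj z c := by
      rcases shiftMatrix_cases (G := G) (t := t) hcz with ⟨zc, e⟩ | ⟨zc, e⟩ <;> rw [e] at s2
      · have ht2 : t = 2 := by grind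
        exact ⟨ht2, by subst ht2; linear_combination ht, zc⟩
      · grind
    obtain ⟨ht2, h5, zc⟩ := h5
    obtain ⟨d, hdz, vd, zd⟩ := hk.exists_second_adj_not_adj (v := z) (u := v) (x := v) (y := w)
      ⟨vz.symm, G.irrefl⟩ ⟨wz.symm, vw⟩ hvw z
    have ud : G.Adj u d := by
      by_contra ud
      exact hdz (uniq_z d vd ud)
    have hdz := (hcne ⟨ud, vd⟩).2
    have hdw := (hcne ⟨ud, vd⟩).1
    have mud := shiftMatrix_of_adj (t := t) ud
    have mvd := shiftMatrix_of_adj (t := t) vd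
    have mzd := shiftMatrix_of_not_adj (t := t) hdz zd
    have hcd : c ≠ d := by rintro rfl; exact zd zc
    have wd : G.Adj w d := by
      by_contra wd
      have s3 := S w w z d
      have mwd := shiftMatrix_of_not_adj (t := t) hdw wd
      simp only [shiftMatrix_self, muw, mvw, mvz, muz, mzw, mud, mvd, mwd, mzd] at s3
      grind
    have ncd : ¬ G.Adj c d := by
      intro cd
      have s3 := S w w c d
      have mwd := shiftMatrix_of_adj (t := t) wd
      have mcd := shiftMatrix_of_adj (t := t) cd
      have mcw := shiftMatrix_of_not_adj (t := t) hcw.symm (fun h => wc h.symm)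
      simp only [shiftMatrix_self, muw, mvw, muc, mvc, mud, mvd, mwd, mcd, mcw] at s3
      grind
    have huniq : ∀ x, G.Adj u x ∧ G.Adj v x → x = c ∨ x = d := by
      rintro x ⟨ux, vx⟩
      by_contra! hx
      have s3 := S w w z x
      have s4 := S w w c x
      have s5 := S w w d x
      have mux := shiftMatrix_of_adj (t := t) ux
      have mvx := shiftMatrix_of_adj (t := t) vx
      have mcw := shiftMatrix_of_not_adj (t := t) hcw.symm (fun h => wc h.symm)
      have mdw := shiftMatrix_of_adj (t := t) wd.symm
      simp only [shiftMatrix_self, muw, mvw, mvz, muz, mzw, mux, mvx, muc, mvc, mcw, mud, mvd,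
        mdw] at s3 s4 s5
      rcases shiftMatrix_cases (G := G) (t := t) (hcne ⟨ux, vx⟩).1 with ⟨-, e1⟩ | ⟨-, e1⟩ <;>
      rcases shiftMatrix_cases (G := G) (t := t) (hcne ⟨ux, vx⟩).2 with ⟨-, e2⟩ | ⟨-, e2⟩ <;>
      rcases shiftMatrix_cases (G := G) (t := t) (hx.1.symm) with ⟨-, e3⟩ | ⟨-, e3⟩ <;>
      rcases shiftMatrix_cases (G := G) (t := t) (hx.2.symm) with ⟨-, e4⟩ | ⟨-, e4⟩ <;>
      rw [e1] at s3 s4 s5 <;> rw [e2] at s3 <;> rw [e3] at s4 <;> rw [e4] at s5 <;>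
      clear e1 e2 e3 e4 S s1 s2 <;> grind
    right
    refine nonempty_iso_prism (a := u) (b := w) (c := d) (d := c) (e := z) (f := v) ?_ uw wd ud
      zc.symm vz.symm vc.symm uc wz vd.symm uz nuv wc (fun h => vw h.symm) (fun h => ncd h.symm)
      (fun h => zd h.symm)
    intro s
    have := hall s
    have := huniq s
    tauto

end SimpleGraph

/-! ### Blow-ups as maps to a finite set of classes. -/

theorem zmod_two_eq_zero_or_one : ∀ t : ZMod 2, t = 0 ∨ t = 1 := by decide

theorem exists_equiv_sigma_fin {V ι : Type*} [Fintype V] [DecidableEq ι] {f : V → ι} {s : ι → ℕ}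
    (h : ∀ i, (Finset.univ.filter fun v => f v = i).card = s i) :
    ∃ e : V ≃ Σ i, Fin (s i), ∀ v, (e v).1 = f v := by
  have h1 : ∀ i, Nonempty ({v // f v = i} ≃ Fin (s i)) := fun i => by
    rw [← Fintype.card_eq, Fintype.card_subtype, h, Fintype.card_fin]
  exact ⟨(Equiv.sigmaFiberEquiv f).symm.trans (Equiv.sigmaCongrRight fun i => (h1 i).some),
    fun _ => rfl⟩

theorem card_fiber_of_equiv_sigma_fin {V ι : Type*} [Fintype V] [Fintype ι] [DecidableEq ι]
    {s : ι → ℕ} (e : V ≃ Σ i, Fin (s i)) (i : ι) :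
    (Finset.univ.filter fun v => (e v).1 = i).card = s i := by
  have h : (Finset.univ.filter fun v => (e v).1 = i).map e.toEmbedding =
      Finset.univ.map (Function.Embedding.sigmaMk (β := fun i => Fin (s i)) i) := by
    ext ⟨j, x⟩
    simp only [Finset.mem_filter, Finset.mem_univ, true_and, Finset.mem_map]
    constructor
    · rintro ⟨v, hv, hx⟩
      have hj : j = i := by rw [← hv]; exact (congrArg Sigma.fst hx).symm
      subst hj
      exact ⟨x, rfl⟩
    · rintro ⟨y, hy⟩
      exact ⟨e.symm ⟨j, x⟩, by simpa using (congrArg Sigma.fst hy).symm, e.apply_symm_apply _⟩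
  rw [← Finset.card_map e.toEmbedding, h, Finset.card_map, Finset.card_univ, Fintype.card_fin]

theorem card_eq_mul_of_card_fiber {V : Type*} [Fintype V] {m r : ℕ} {f : V → Fin m}
    (h : ∀ i, (Finset.univ.filter fun v => f v = i).card = r) : Fintype.card V = m * r := by
  obtain ⟨e, -⟩ := exists_equiv_sigma_fin h
  simpa using Fintype.card_congr e

open Matrix in
theorem rank_le_three_of_factor {V κ F : Type*} [Fintype V] [Field F] {M : Matrix V V F} (f : V → κ)
    (X : κ → Fin 3 → F) (Y : Fin 3 → κ → F) (h : ∀ v w, M v w = ∑ l, X (f v) l * Y l (f w)) :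
    M.rank ≤ 3 := by
  have h1 : M = (of fun v l => X (f v) l) * (of fun l w => Y l (f w)) := by
    ext v w
    rw [h, mul_apply]
    rfl
  rw [h1]
  exact (rank_mul_le_left _ _).trans ((rank_le_card_width _).trans (by simp))

namespace SimpleGraph

/-- The complete multipartite graph with two parts is the complete bipartite graph. -/
def completeMultipartiteTwoIso (W : Type*) :
    completeMultipartiteGraph (fun _ : Fin 2 => W) ≃g completeBipartiteGraph W W where
  toFun x := if x.1 = 0 then .inl x.2 else .inr x.2
  invFun := Sum.elim (fun x => ⟨0, x⟩) fun x => ⟨1, x⟩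
  left_inv := by
    rintro ⟨i, x⟩
    fin_cases i <;> rfl
  right_inv := by rintro (x | x) <;> rfl
  map_rel_iff' := by
    rintro ⟨i, x⟩ ⟨j, y⟩
    fin_cases i <;> fin_cases j <;> simp

variable {V : Type*} [Fintype V] {G : SimpleGraph V}

theorem nonempty_iso_completeMultipartiteGraph_iff {m r : ℕ} :
    Nonempty (G ≃g completeMultipartiteGraph fun _ : Fin m => Fin r) ↔
      ∃ f : V → Fin m, (∀ i, (Finset.univ.filter fun v => f v = i).card = r) ∧
        ∀ v w, G.Adj v w ↔ f v ≠ f w := by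
  constructor
  · rintro ⟨g⟩
    exact ⟨fun v => (g v).1, fun i => card_fiber_of_equiv_sigma_fin (s := fun _ => r) g.toEquiv i,
      fun v w => g.map_adj_iff.symm⟩
  · rintro ⟨f, hf, hadj⟩
    obtain ⟨e, he⟩ := exists_equiv_sigma_fin hf
    exact ⟨e, fun {v w} => by rw [hadj, ← he, ← he]; rfl⟩

theorem nonempty_iso_thickGraph_iff {r : ℕ} (hr : 1 ≤ r) :
    Nonempty (G ≃g thickGraph (cycleGraph 4) fun _ => -(r : ℤ)) ↔
      ∃ f : V → Fin 4, (∀ i, (Finset.univ.filter fun v => f v = i).card = r) ∧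
        ∀ v w, (v = w ∨ G.Adj v w) ↔ (f v = f w ∨ (cycleGraph 4).Adj (f v) (f w)) := by
  have hr' : -(r : ℤ) < 0 := by omega
  constructor
  · rintro ⟨g⟩
    refine ⟨fun v => (g v).1, fun i => ?_, fun v w => ?_⟩
    · exact (card_fiber_of_equiv_sigma_fin (s := fun _ => (-(r : ℤ)).natAbs) g.toEquiv i).trans
        (by simp)
    · rw [← g.map_adj_iff, ← g.injective.eq_iff (a := v)]
      change _ ∨ (_ ∨ _ ∧ _ ∧ -(r : ℤ) < 0) ↔ _
      by_cases h : g v = g w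
      · simp [h]
      · simp only [h, hr', false_or, ne_eq, not_false_eq_true, true_and, and_true]
        rw [or_comm]
  · rintro ⟨f, hf, hadj⟩
    obtain ⟨e, he⟩ := exists_equiv_sigma_fin (f := f) (s := fun _ => (-(r : ℤ)).natAbs)
      (by simpa using hf)
    refine ⟨e, fun {v w} => ?_⟩
    change (_ ∨ _ ∧ _ ∧ -(r : ℤ) < 0) ↔ _
    rw [he, he]
    have := hadj v w
    by_cases h : v = w
    · simp [h]
    · simp only [h, false_or] at this
      rw [this, ne_eq, e.injective.eq_iff]
      simp only [h, hr', not_false_eq_true, true_and, and_true]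
      rw [or_comm]

variable [DecidableEq V] [DecidableRel G.Adj] {k : ℕ}

-- Nonadjacency is an equivalence relation and its classes are the parts. The class of v consists of
-- v and its non-neighbours, and representatives of five classes would form a K_5.
omit [DecidableEq V] in
theorem IsRegularOfDegree.exists_multipartite_map (hk : G.IsRegularOfDegree k)
    (htrans : ∀ u v w, ¬ G.Adj u v → ¬ G.Adj v w → ¬ G.Adj u w)
    (h5 : ∀ f : Fin 5 → V, ¬ ∀ i j, i ≠ j → G.Adj (f i) (f j)) :
    ∃ m ≤ 4, ∃ f : V → Fin m,
      (∀ i, (Finset.univ.filter fun v => f v = i).card = Fintype.card V - k) ∧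
        ∀ v w, G.Adj v w ↔ f v ≠ f w := by
  classical
  let s : Setoid V := ⟨fun v w => ¬ G.Adj v w, fun _ => G.irrefl, fun h h' => h h'.symm,
    fun h h' => htrans _ _ _ h h'⟩
  let e := Fintype.equivFin (Quotient s)
  let f : V → Fin (Fintype.card (Quotient s)) := fun v => e (Quotient.mk s v)
  have hadj : ∀ v w, G.Adj v w ↔ f v ≠ f w := fun v w => by
    rw [ne_eq, e.injective.eq_iff, Quotient.eq]
    exact not_not.symm
  have hsurj : ∀ i, ∃ v, f v = i := fun i => by
    obtain ⟨v, hv⟩ := Quotient.exists_rep (e.symm i)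
    exact ⟨v, by rw [← e.apply_symm_apply i, ← hv]⟩
  refine ⟨_, ?_, f, fun i => ?_, hadj⟩
  · by_contra! hlt
    choose g hg using hsurj
    refine h5 (fun i => g (Fin.castLE hlt i)) fun i j hij => ?_
    rw [hadj, hg, hg]
    exact fun h => hij (Fin.castLE_injective hlt h)
  · obtain ⟨v, rfl⟩ := hsurj i
    rw [← hk.card_not_adj v]
    congr 1
    ext w
    simp only [Finset.mem_filter, Finset.mem_univ, true_and, hadj, ne_eq, not_not]
    exact eq_comm

/-! ### Reduction of the Laplacian mod p, and membership of the listed graphs. -/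

theorem IsRegularOfDegree.map_lapMatrix {F : Type*} [Field F] (hk : G.IsRegularOfDegree k) :
    (G.lapMatrix ℤ).map (Int.cast : ℤ → F) = -G.shiftMatrix (-(k : F)) := by
  ext v w
  by_cases h : v = w
  · subst h
    simp [lapMatrix, degMatrix, hk v]
  · by_cases h' : G.Adj v w <;> simp [lapMatrix, degMatrix, h, h', shiftMatrix]

theorem IsRegularOfDegree.inCriticalFamilyLE_iff (hG : G.Connected) (hk : G.IsRegularOfDegree k) :
    InCriticalFamilyLE G 3 ↔ ∃ p : ℕ, ∃ _ : Fact p.Prime,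
      (G.shiftMatrix (-(k : ZMod p))).rank ≤ 3 := by
  rw [InCriticalFamilyLE, atMostInvariantFactorsOne_iff]
  have : ∀ p : ℕ, ∀ _ : Fact p.Prime, ((G.lapMatrix ℤ).map (Int.cast : ℤ → ZMod p)).rank =
      (G.shiftMatrix (-(k : ZMod p))).rank := fun p _ => by
    rw [hk.map_lapMatrix, ← neg_one_mul, Matrix.rank_mul_eq_right_of_isUnit_det]
    exact (Matrix.isUnit_iff_isUnit_det _).1 isUnit_one.neg
  simp only [this, hG, true_and]

/-- Reduction of the rank bound to a small matrix for blow-ups. -/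
theorem IsRegularOfDegree.inCriticalFamilyLE_of_factor (hG : G.Connected)
    (hk : G.IsRegularOfDegree k) (p : ℕ) [hp : Fact p.Prime] {κ : Type*} (f : V → κ)
    (X : κ → Fin 3 → ZMod p) (Y : Fin 3 → κ → ZMod p)
    (h : ∀ v w, G.shiftMatrix (-(k : ZMod p)) v w = ∑ l, X (f v) l * Y l (f w)) :
    InCriticalFamilyLE G 3 :=
  (hk.inCriticalFamilyLE_iff hG).2 ⟨p, hp, rank_le_three_of_factor f X Y h⟩

theorem IsRegularOfDegree.inCriticalFamilyLE_of_card (hG : G.Connected)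
    (hk : G.IsRegularOfDegree k) (h : Fintype.card V ≤ 3) : InCriticalFamilyLE G 3 :=
  (hk.inCriticalFamilyLE_iff hG).2
    ⟨2, ⟨Nat.prime_two⟩, (Matrix.rank_le_card_width _).trans h⟩

/-- The vertex `w₀` only serves to read off k as a degree in the concrete graph `H`. -/
theorem IsRegularOfDegree.inCriticalFamilyLE_of_iso (hG : G.Connected)
    (hk : G.IsRegularOfDegree k) (p : ℕ) [Fact p.Prime] {W : Type*} [Fintype W] [DecidableEq W]
    {H : SimpleGraph W} [DecidableRel H.Adj] (g : G ≃g H) (t : ZMod p) (w₀ : W)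
    (ht : -(H.degree w₀ : ZMod p) = t) (X : W → Fin 3 → ZMod p) (Y : Fin 3 → W → ZMod p)
    (h : ∀ v w, H.shiftMatrix t v w = ∑ l, X v l * Y l w) : InCriticalFamilyLE G 3 := by
  refine hk.inCriticalFamilyLE_of_factor hG p g X Y fun v w => ?_
  have hk' : k = H.degree w₀ := by
    rw [← hk (g.symm w₀), ← g.degree_eq, g.apply_symm_apply]
  rw [← h, ← ht, hk']
  simp only [shiftMatrix, g.injective.eq_iff, g.map_adj_iff]

instance factPrimeFive : Fact (Nat.Prime 5) := ⟨Nat.prime_five⟩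

theorem inCriticalFamilyLE_of_iso_cycleGraph_five (hG : G.Connected) (hk : G.IsRegularOfDegree k)
    (g : G ≃g cycleGraph 5) : InCriticalFamilyLE G 3 := by
  refine hk.inCriticalFamilyLE_of_iso hG 5 g 3 0 (by decide)
    ![![1, 0, 0], ![0, 1, 0], ![0, 0, 1], ![1, 2, 3], ![3, 2, 1]]
    ![![3, 1, 0, 0, 1], ![1, 3, 1, 0, 0], ![0, 1, 3, 1, 0]] ?_
  unfold shiftMatrix
  decide

theorem inCriticalFamilyLE_of_iso_prism (hG : G.Connected) (hk : G.IsRegularOfDegree k)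
    (g : G ≃g (completeGraph (Fin 3)).boxProd (completeGraph (Fin 2))) :
    InCriticalFamilyLE G 3 := by
  classical
  -- The blocks of the matrix are J + I, I, I, J + I with J all ones of size 3. Since (J + I)² = 5J
  -- + I, modulo 5 the lower rows are J + I times the upper ones.
  refine hk.inCriticalFamilyLE_of_iso hG 5 g 2 (0, 0) ?_
    (fun x l => if x.2 = 0 then if x.1 = l then 1 else 0 else if x.1 = l then 2 else 1)
    (fun l x => if x.2 = 0 then if x.1 = l then 2 else 1 else if x.1 = l then 1 else 0) ?_
  · rw [degree_boxProd]
    simp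
    decide
  · simp only [shiftMatrix, boxProd_adj, completeGraph_eq_top, top_adj]
    decide

theorem inCriticalFamilyLE_of_eq_top (hG : G.Connected) (hk : G.IsRegularOfDegree k)
    (htop : G = ⊤) : InCriticalFamilyLE G 3 := by
  by_cases hn : Fintype.card V = 1
  · exact hk.inCriticalFamilyLE_of_card hG (by omega)
  obtain ⟨p, hp, hpn⟩ := Nat.exists_prime_and_dvd hn
  have : Fact p.Prime := ⟨hp⟩
  obtain ⟨v₀⟩ := hG.nonempty
  have hkn : k + 1 = Fintype.card V := by
    have h1 := hk.card_not_adj v₀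
    have h2 : (Finset.univ.filter fun w => ¬ G.Adj v₀ w) = {v₀} := by
      ext w; simp [htop, eq_comm]
    have := Fintype.card_pos_iff.2 hG.nonempty
    rw [h2, Finset.card_singleton] at h1
    omega
  have hkp : -(k : ZMod p) = 1 := by
    rw [← ZMod.natCast_eq_zero_iff, ← hkn] at hpn
    push_cast at hpn
    linear_combination -hpn
  refine hk.inCriticalFamilyLE_of_factor hG p (fun _ => ()) (fun _ l => if l = 0 then 1 else 0)
    (fun _ _ => 1) fun v w => ?_
  rw [hkp]
  by_cases h : v = w <;> simp [shiftMatrix, h, htop]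

theorem inCriticalFamilyLE_of_multipartite (hG : G.Connected) (hk : G.IsRegularOfDegree k)
    {m r : ℕ} (hm : m ≤ 4) {f : V → Fin m}
    (hf : ∀ i, (Finset.univ.filter fun v => f v = i).card = r)
    (hadj : ∀ v w, G.Adj v w ↔ f v ≠ f w) : InCriticalFamilyLE G 3 := by
  have hcard := card_eq_mul_of_card_fiber hf
  obtain ⟨v₀⟩ := hG.nonempty
  have hkr : k + r = m * r := by
    have h1 := hk.card_not_adj v₀
    simp only [hadj, not_not] at h1
    have h2 := hf (f v₀)
    simp only [eq_comm] at h1 h2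
    have := hk.degree_eq v₀ ▸ G.degree_lt_card_verts v₀
    omega
  have hM : ∀ (p : ℕ) [Fact p.Prime], (p : ℤ) ∣ (k : ℤ) → ∀ v w,
      G.shiftMatrix (-(k : ZMod p)) v w = if f v = f w then 0 else 1 := by
    intro p _ hpk v w
    have : (k : ZMod p) = 0 := by
      rw [ZMod.natCast_eq_zero_iff]; exact_mod_cast hpk
    by_cases h : v = w
    · simp [h, this]
    · simp [shiftMatrix, h, hadj, ite_not]
  by_cases hm4 : m = 4
  · subst hm4
    -- Here k = 3r and t = 0 mod 3. The rows of the 4×4 matrix J - I sum to zero mod 3, so the last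
    -- row is twice the sum of the others.
    refine hk.inCriticalFamilyLE_of_factor hG 3 f
      ![![1, 0, 0], ![0, 1, 0], ![0, 0, 1], ![2, 2, 2]]
      ![![0, 1, 1, 1], ![1, 0, 1, 1], ![1, 1, 0, 1]] fun v w => ?_
    rw [hM 3 (by omega)]
    generalize f v = i
    generalize f w = j
    revert i j
    decide
  -- For r ≠ 1, a prime divisor of r divides k = (m - 1)r, so t = 0; an m×m quotient matrix with m ≤
  -- 3 needs no further relation.
  · by_cases hr : r = 1
    · exact hk.inCriticalFamilyLE_of_card hG (by subst hr; omega)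
    obtain ⟨p, hp, hpr⟩ := Nat.exists_prime_and_dvd hr
    have : Fact p.Prime := ⟨hp⟩
    have hpk : p ∣ k := (Nat.dvd_add_left hpr).1 (hkr ▸ hpr.mul_left m)
    have hm3 : m ≤ 3 := by omega
    refine hk.inCriticalFamilyLE_of_factor hG p (fun v => Fin.castLE hm3 (f v))
      (fun i l => if i = l then 1 else 0) (fun l j => if l = j then 0 else 1) fun v w => ?_
    rw [hM p (by exact_mod_cast hpk)]
    simp only [ite_mul, one_mul, zero_mul, Finset.sum_ite_eq, Finset.mem_univ, if_true,
      Fin.castLE_inj]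

theorem inCriticalFamilyLE_of_thick_cycle (hG : G.Connected) (hk : G.IsRegularOfDegree k)
    {r : ℕ} {f : V → Fin 4} (hf : ∀ i, (Finset.univ.filter fun v => f v = i).card = r)
    (hadj : ∀ v w, (v = w ∨ G.Adj v w) ↔ (f v = f w ∨ (cycleGraph 4).Adj (f v) (f w))) :
    InCriticalFamilyLE G 3 := by
  have hcard := card_eq_mul_of_card_fiber hf
  have hadj' : ∀ v w, (v = w ∨ G.Adj v w) ↔ f w ≠ f v + 2 := fun v w => by
    rw [hadj]
    generalize f v = i
    generalize f w = j
    revert i j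
    decide
  obtain ⟨v₀⟩ := hG.nonempty
  have hkr : k + r + 1 = 4 * r := by
    have h1 := hk.card_ne_not_adj v₀
    simp only [hadj', not_not] at h1
    have h2 := hf (f v₀ + 2)
    have := hk.degree_eq v₀ ▸ G.degree_lt_card_verts v₀
    omega
  have hk3 : -(k : ZMod 3) = 1 := by
    have h1 : ((k + 1 : ℕ) : ZMod 3) = 0 := by
      rw [ZMod.natCast_eq_zero_iff]; omega
    push_cast at h1
    linear_combination -h1
  -- Here k = 3r - 1, so t = 1 mod 3. The rows of A(C_4) + I sum to zero mod 3, which gives the last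
  -- row.
  refine hk.inCriticalFamilyLE_of_factor hG 3 f
    ![![1, 0, 0], ![0, 1, 0], ![0, 0, 1], ![2, 2, 2]]
    ![![1, 1, 0, 1], ![1, 1, 1, 0], ![0, 1, 1, 1]] fun v w => ?_
  have h1 : G.shiftMatrix (-(k : ZMod 3)) v w = if f w ≠ f v + 2 then 1 else 0 := by
    rw [hk3, ← if_congr (hadj' v w) rfl rfl]
    rcases shiftMatrix_one_cases (F := ZMod 3) (G := G) (v := v) (w := w) with ⟨h, e⟩ | ⟨h, e⟩
    · rw [e, if_pos h]
    · rw [e, if_neg h]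
  rw [h1]
  generalize f v = i
  generalize f w = j
  revert i j
  decide

/-! ### Assembly of the classification. -/

omit [DecidableEq V] [DecidableRel G.Adj] in
theorem nonempty_iso_completeGraph (hG : G.Connected) (htop : G = ⊤) :
    ∃ r : ℕ, 1 ≤ r ∧ Nonempty (G ≃g completeGraph (Fin r)) :=
  ⟨Fintype.card V, Fintype.card_pos_iff.2 hG.nonempty, Fintype.equivFin V, by simp [htop]⟩

theorem exists_family_of_multipartite {F : Type*} [Field F] {t : F} (hG : G.Connected)
    (hk : G.IsRegularOfDegree k) (h : (G.shiftMatrix t).rank ≤ 3) (ht : t ≠ 1)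
    (htrans : ∀ u v w, ¬ G.Adj u v → ¬ G.Adj v w → ¬ G.Adj u w) :
    (∃ r : ℕ, 1 ≤ r ∧ Nonempty (G ≃g completeGraph (Fin r))) ∨
    (∃ r : ℕ, 1 ≤ r ∧ Nonempty (G ≃g completeBipartiteGraph (Fin r) (Fin r))) ∨
    (∃ r : ℕ, 1 ≤ r ∧ Nonempty (G ≃g completeMultipartiteGraph (fun _ : Fin 3 => Fin r))) ∨
    (∃ r : ℕ, 1 ≤ r ∧ Nonempty (G ≃g completeMultipartiteGraph (fun _ : Fin 4 => Fin r))) := by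
  obtain ⟨m, hm, f, hf, hadj⟩ := hk.exists_multipartite_map htrans
    fun g hg => not_clique_five h ht g hg
  obtain ⟨v₀⟩ := hG.nonempty
  have hr : 1 ≤ Fintype.card V - k := by
    rw [← hf (f v₀), Nat.one_le_iff_ne_zero, ← Nat.pos_iff_ne_zero, Finset.card_pos]
    exact ⟨v₀, by simp⟩
  have hiso := nonempty_iso_completeMultipartiteGraph_iff.2 ⟨f, hf, hadj⟩
  interval_cases m
  · exact (f v₀).elim0
  -- A single part means no edges, so connectedness leaves one vertex, the graph K_1.
  · left
    refine nonempty_iso_completeGraph hG ?_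
    have hsub : ∀ v, v = v₀ := hG.mem_of_closed (S := {v₀}) rfl fun x _ y hxy =>
      ((hadj x y).1 hxy (Subsingleton.elim _ _)).elim
    ext v w
    simp [hsub v, hsub w]
  · obtain ⟨g⟩ := hiso
    exact .inr (.inl ⟨_, hr, ⟨g.trans (completeMultipartiteTwoIso _)⟩⟩)
  · exact .inr (.inr (.inl ⟨_, hr, hiso⟩))
  · exact .inr (.inr (.inr ⟨_, hr, hiso⟩))

end SimpleGraph

theorem mainTheorem2 {V : Type*} [Fintype V] [DecidableEq V]
    (G : SimpleGraph V) [DecidableRel G.Adj]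
    (hconn : G.Connected) (hreg : ∃ k : ℕ, G.IsRegularOfDegree k) :
    InCriticalFamilyLE G 3 ↔
      (Nonempty (G ≃g SimpleGraph.cycleGraph 5) ∨
       Nonempty (G ≃g (SimpleGraph.completeGraph (Fin 3)).boxProd
          (SimpleGraph.completeGraph (Fin 2))) ∨
       (∃ r : ℕ, 1 ≤ r ∧ Nonempty (G ≃g SimpleGraph.completeGraph (Fin r))) ∨
       (∃ r : ℕ, 1 ≤ r ∧ Nonempty (G ≃g completeBipartiteGraph (Fin r) (Fin r))) ∨
       (∃ r : ℕ, 1 ≤ r ∧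
          Nonempty (G ≃g SimpleGraph.completeMultipartiteGraph (fun _ : Fin 3 => Fin r))) ∨
       (∃ r : ℕ, 1 ≤ r ∧
          Nonempty (G ≃g SimpleGraph.completeMultipartiteGraph (fun _ : Fin 4 => Fin r))) ∨
       (∃ r : ℕ, 1 ≤ r ∧
          Nonempty (G ≃g thickGraph (SimpleGraph.cycleGraph 4) (fun _ => -(r : ℤ))))) := by
  obtain ⟨k, hk⟩ := hreg
  constructor
  · rw [hk.inCriticalFamilyLE_iff hconn]
    rintro ⟨p, hp, h⟩
    by_cases h1 : -(k : ZMod p) = 1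
    · rw [h1] at h
      by_cases htop : G = ⊤
      · exact .inr (.inr (.inl (SimpleGraph.nonempty_iso_completeGraph hconn htop)))
      · obtain ⟨r, hr, hf⟩ := SimpleGraph.shift_one_classification hconn hk htop h
        exact .inr (.inr (.inr (.inr (.inr (.inr
          ⟨r, hr, (SimpleGraph.nonempty_iso_thickGraph_iff hr).2 hf⟩)))))
    · by_cases htrans : ∀ u v w, ¬ G.Adj u v → ¬ G.Adj v w → ¬ G.Adj u w
      · rcases SimpleGraph.exists_family_of_multipartite hconn hk h h1 htrans with h | h | h | h
        · exact .inr (.inr (.inl h))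
        · exact .inr (.inr (.inr (.inl h)))
        · exact .inr (.inr (.inr (.inr (.inl h))))
        · exact .inr (.inr (.inr (.inr (.inr (.inl h)))))
      · have h0 : -(k : ZMod p) ≠ 0 := fun h0 => by
          rw [h0] at h
          exact htrans fun u v w => SimpleGraph.not_adj_trans_of_shift_zero hconn h
        -- Characteristic 2 is already covered, since t is then 0 or 1.
        have h2 : (2 : ZMod p) ≠ 0 := fun h2 => by
          have hp2 : p = 2 := (Nat.prime_dvd_prime_iff_eq hp.out Nat.prime_two).1
            ((ZMod.natCast_eq_zero_iff 2 p).1 (by exact_mod_cast h2))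
          subst hp2
          exact (zmod_two_eq_zero_or_one _).elim h0 h1
        push Not at htrans
        obtain ⟨u, v, w, huv, hvw, huw⟩ := htrans
        have hne : u ≠ v := by rintro rfl; exact hvw huw
        rcases SimpleGraph.shift_generic_classification hconn hk h h0 h1 h2 hne huv huw hvw with
          h | h
        · exact .inl h
        · exact .inr (.inl h)
  · rintro (⟨⟨g⟩⟩ | ⟨⟨g⟩⟩ | ⟨r, hr, ⟨g⟩⟩ | ⟨r, hr, ⟨g⟩⟩ | ⟨r, hr, hg⟩ | ⟨r, hr, hg⟩ | ⟨r, hr, hg⟩)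
    · exact SimpleGraph.inCriticalFamilyLE_of_iso_cycleGraph_five hconn hk g
    · exact SimpleGraph.inCriticalFamilyLE_of_iso_prism hconn hk g
    · refine SimpleGraph.inCriticalFamilyLE_of_eq_top hconn hk ?_
      ext v w
      rw [← g.map_adj_iff]
      simp [g.injective.eq_iff]
    · obtain ⟨f, hf, hadj⟩ := SimpleGraph.nonempty_iso_completeMultipartiteGraph_iff.1
        ⟨g.trans (SimpleGraph.completeMultipartiteTwoIso _).symm⟩
      exact SimpleGraph.inCriticalFamilyLE_of_multipartite hconn hk (by norm_num) hf hadj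
    · obtain ⟨f, hf, hadj⟩ := SimpleGraph.nonempty_iso_completeMultipartiteGraph_iff.1 hg
      exact SimpleGraph.inCriticalFamilyLE_of_multipartite hconn hk (by norm_num) hf hadj
    · obtain ⟨f, hf, hadj⟩ := SimpleGraph.nonempty_iso_completeMultipartiteGraph_iff.1 hg
      exact SimpleGraph.inCriticalFamilyLE_of_multipartite hconn hk (by norm_num) hf hadj
    · obtain ⟨f, hf, hadj⟩ := (SimpleGraph.nonempty_iso_thickGraph_iff hr).1 hg
      exact SimpleGraph.inCriticalFamilyLE_of_thick_cycle hconn hk hf hadj
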